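/- Let $A$ be a finite alphabet and $V$ a finite set of variables, disjoint from $A$. A word equation $E$ is a pair $L=R$ with $L,R\in(A\cup V)^*$; it is quadratic if each variable occurs at most twice in $L$ and $R$ together. A solution of $E$ is a homomorphism $\sigma:(A\cup V)^*\to A^*$ with $\sigma(c)=c$ for all $c\in A$ and $\sigma(L)=\sigma(R)$. The length abstraction of $E$, with $V=\{x_1,\ldots,x_k\}$, is $\mathrm{Len}(E)=\{(|\sigma(x_1)|,\ldots,|\sigma(x_k)|) : \sigma \text{ is a solution of } E\}\subseteq\mathbb N^k$. A set $S\subseteq\mathbb N^k$ is Presburger-definable if there is a first-order formula $\varphi(z_1,\ldots,z_k)$ over the integers with equality, $\le$, and linear polynomials with integer coefficients as terms, such that for all $n\in\mathbb N^k$: $n\in S$ if and only if $\varphi(n)$ holds. Theorem. (1) Let $A$ be a finite alphabet, let $a\neq b$ be two letters of $A$, and let $V=\{x,y\}$ with $x\ne y$. Then the word equation $xaby=yabx$ is quadratic, and $\mathrm{Len}(xaby=yabx)$ is exactly the set of all pairs $(n_x,n_y)\in\mathbb N^2$ (where $n_x$, $n_y$ are the lengths of $x$, $y$) such that $$n_x=n_y\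 \vee\ (n_x=0\wedge n_y\equiv 0 \!\!\pmod 2)\ \vee\ (n_y=0\wedge n_x\equiv 0\!\!\pmod 2)\ \vee\ (n_x,n_y>0\wedge\gcd(n_x+2,n_y+2)>1).$$ Moreover, this set is not Presburger-definable. (2) Consequently, there is a quadratic word equation whose length abstraction is not Presburger-definable. -/

import Mathlib

/-- A word equation `lhs = rhs` over the alphabet `A` and the set of variables `V`.
Both sides are words over the disjoint union of `A` and `V`. -/
structure WordEquation (A V : Type*) where
  /-- the left-hand side -/
  lhs : FreeMonoid (A ⊕ V)
  /-- the right-hand side -/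
  rhs : FreeMonoid (A ⊕ V)

namespace WordEquation

variable {A V : Type*}

open Classical in
/-- Each variable occurs at most twice in the two sides taken together. -/
def IsQuadratic (E : WordEquation A V) : Prop :=
  ∀ v : V, E.lhs.toList.countP (fun s => decide (s = Sum.inr v)) +
    E.rhs.toList.countP (fun s => decide (s = Sum.inr v)) ≤ 2

/-- A solution is a homomorphism `(A ∪ V)* → A*` that fixes every letter of the alphabet and
equates the two sides. -/
structure IsSolution (E : WordEquation A V) (σ : FreeMonoid (A ⊕ V) →* FreeMonoid A) : Prop where
  map_const : ∀ c : A, σ (FreeMonoid.of (Sum.inl c)) = FreeMonoid.of c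
  map_eq : σ E.lhs = σ E.rhs

/-- The length abstraction: the set of all tuples `(|σ(v)|)`, indexed by the variables `v`, where
`σ` is a solution. -/
def Len (E : WordEquation A V) : Set (V → ℕ) :=
  {n | ∃ σ : FreeMonoid (A ⊕ V) →* FreeMonoid A, E.IsSolution σ ∧
    ∀ v : V, n v = (σ (FreeMonoid.of (Sum.inr v))).length}

end WordEquation

/-- The word equation `x a b y = y a b x`. -/
def xabyEquation {A V : Type*} (a b : A) (x y : V) : WordEquation A V where
  lhs := FreeMonoid.of (Sum.inr x) * FreeMonoid.of (Sum.inl a) * FreeMonoid.of (Sum.inl b) *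
    FreeMonoid.of (Sum.inr y)
  rhs := FreeMonoid.of (Sum.inr y) * FreeMonoid.of (Sum.inl a) * FreeMonoid.of (Sum.inl b) *
    FreeMonoid.of (Sum.inr x)

/-- Function symbols of integer Presburger arithmetic. The terms built from them are the
linear polynomials with integer coefficients. -/
inductive IntPresburgerFunc : ℕ → Type
  | zero : IntPresburgerFunc 0
  | one : IntPresburgerFunc 0
  | neg : IntPresburgerFunc 1
  | add : IntPresburgerFunc 2

/-- Relation symbols of integer Presburger arithmetic (besides equality). -/
inductive IntPresburgerRel : ℕ → Type
  | le : IntPresburgerRel 2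

/-- The first-order language (with equality) of integer Presburger arithmetic. -/
abbrev intPresburger : FirstOrder.Language where
  Functions := IntPresburgerFunc
  Relations := IntPresburgerRel

/-- The standard interpretation in the integers. -/
instance intPresburgerStructure : intPresburger.Structure ℤ where
  funMap
    | .zero, _ => 0
    | .one, _ => 1
    | .neg, t => -t 0
    | .add, t => t 0 + t 1
  RelMap
    | .le, t => t 0 ≤ t 1

/-- A set of tuples of natural numbers is Presburger-definable if some first-order formula of
Presburger arithmetic, with one free variable for each coordinate, holds of a tuple of natural
numbers exactly when the tuple is in the set. Quantifiers range over the integers. -/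
def PresburgerDefinable {V : Type*} (S : Set (V → ℕ)) : Prop :=
  ∃ φ : intPresburger.Formula V, ∀ n : V → ℕ, n ∈ S ↔ φ.Realize (fun v => (n v : ℤ))

/-! Appending ab to both sides of xaby = yabx makes the words xab and yab commute. Coprime lengths
would make both powers of one letter, against a ≠ b. Conversely, if the lengths share a divisor d >
1, both words can be powers of one word of length d ending in ab. So the length abstraction is
gcd(n_x + 2, n_y + 2) > 1, and the four listed cases collapse to this. Presburger-definable sets are
semilinear. Intersecting with n_x < n_y, projecting to y and complementing would make {m | m + 2
prime} semilinear, hence ultimately periodic, which it is not. -/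

namespace List

variable {α : Type*}

/-- Two commuting words of coprime lengths are powers of one letter. -/
theorem exists_forall_mem_eq_of_append_comm (u v : List α) (h : u ++ v = v ++ u)
    (hc : u.length.Coprime v.length) : ∃ c, ∀ z, z ∈ u ∨ z ∈ v → z = c := by
  induction hn : u.length + v.length using Nat.strong_induction_on generalizing u v with
  | _ n ih =>
    wlog hle : u.length ≤ v.length generalizing u v
    · obtain ⟨c, hcz⟩ := this v u h.symm hc.symm (by omega) (by omega)
      exact ⟨c, fun z hz => hcz z hz.symm⟩
    obtain ⟨w, rfl⟩ : u <+: v :=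
      List.prefix_of_prefix_length_le (List.prefix_append u v) (h ▸ List.prefix_append v u) hle
    rcases u.eq_nil_or_concat' with rfl | ⟨u', d, rfl⟩
    · obtain ⟨c, rfl⟩ : ∃ c, w = [c] := by
        rw [← List.length_eq_one_iff]
        simpa using hc
      exact ⟨c, by simp⟩
    -- Euclidean step: cancelling u in u(uw) = (uw)u leaves the shorter commuting pair u, w, still
    -- of coprime lengths.
    · obtain ⟨c, hcz⟩ := ih ((u' ++ [d]).length + w.length) (by simp at hn ⊢; omega)
        (u' ++ [d]) w (by simpa [List.append_assoc] using h)
        (by rwa [List.length_append (as := u' ++ [d]), Nat.coprime_self_add_right] at hc) rfl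
      refine ⟨c, fun z hz => hcz z ?_⟩
      simp only [List.mem_append] at hz ⊢
      tauto

end List

theorem FreeMonoid.length_pow {α : Type*} (w : FreeMonoid α) (j : ℕ) :
    (w ^ j).length = j * w.length := by
  induction j with
  | zero => simp
  | succ j ih => rw [pow_succ, FreeMonoid.length_mul, ih, add_one_mul]

section LengthAbstraction

variable {A V : Type*} {a b : A} {x y : V}

theorem xabyEquation_isQuadratic (hxy : x ≠ y) : (xabyEquation a b x y).IsQuadratic := by
  intro v
  by_cases hx : x = v <;> by_cases hy : y = v <;>
    simp_all [xabyEquation, FreeMonoid.toList_mul, FreeMonoid.toList_of]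

theorem one_lt_gcd_of_mem_Len (hab : a ≠ b) {n : V → ℕ} (hn : n ∈ (xabyEquation a b x y).Len) :
    1 < Nat.gcd (n x + 2) (n y + 2) := by
  obtain ⟨σ, ⟨hc, he⟩, hl⟩ := hn
  by_contra hlt
  have hpos : 0 < Nat.gcd (n x + 2) (n y + 2) := Nat.gcd_pos_of_pos_left _ (by omega)
  simp only [xabyEquation, map_mul, hc] at he
  obtain ⟨c, h⟩ := List.exists_forall_mem_eq_of_append_comm
    ((σ (.of (.inr x))).toList ++ [a, b]) ((σ (.of (.inr y))).toList ++ [a, b])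
    (by
      have := congrArg (fun w => FreeMonoid.toList w ++ [a, b]) he
      simpa [FreeMonoid.toList_mul, FreeMonoid.toList_of] using this)
    (by
      have h1 : (σ (.of (.inr x))).toList.length = n x := (hl x).symm
      have h2 : (σ (.of (.inr y))).toList.length = n y := (hl y).symm
      simp only [List.length_append, h1, h2, List.length_cons, List.length_nil]
      rw [Nat.coprime_iff_gcd_eq_one]
      simp only [zero_add, Nat.reduceAdd]
      omega)
  exact hab ((h a (by simp)).trans (h b (by simp)).symm)

theorem mem_Len_of_one_lt_gcd (hxy : x ≠ y) (hV : ∀ v : V, v = x ∨ v = y) {n : V → ℕ}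
    (hn : 1 < Nat.gcd (n x + 2) (n y + 2)) : n ∈ (xabyEquation a b x y).Len := by
  classical
  obtain ⟨e, he⟩ : ∃ e, Nat.gcd (n x + 2) (n y + 2) = e + 2 := ⟨_, (Nat.sub_add_cancel hn).symm⟩
  have key : ∀ v : V, ∃ i, n v + 2 = (e + 2) * (i + 1) := by
    intro v
    have hd : (e + 2) ∣ n v + 2 := by
      rcases hV v with rfl | rfl
      · exact he ▸ Nat.gcd_dvd_left _ _
      · exact he ▸ Nat.gcd_dvd_right _ _
    obtain ⟨k, hk⟩ := hd
    cases k with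
    | zero => omega
    | succ i => exact ⟨i, hk⟩
  choose i hi using key
  -- `W` has length `e + 2`, the gcd; `W ^ i v * P` is `W ^ (i v + 1)` without its final ab.
  let P : FreeMonoid A := .of a ^ e
  let W : FreeMonoid A := P * .of a * .of b
  have hP : P.length = e := by simp [P, FreeMonoid.length_pow]
  have hW : ∀ j : ℕ, (W ^ j).length = j * (e + 2) := by
    intro j
    simp [W, FreeMonoid.length_pow, FreeMonoid.length_mul, FreeMonoid.length_of, hP]
  refine ⟨FreeMonoid.lift (Sum.elim .of fun v => W ^ i v * P), ⟨fun c => by simp, ?_⟩, fun v => ?_⟩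
  · have h : ∀ j k : ℕ, W ^ j * P * .of a * .of b * (W ^ k * P) = W ^ (j + 1 + k) * P := by
      intro j k
      rw [pow_add, pow_succ]
      simp only [W, mul_assoc]
    simp only [xabyEquation, map_mul, FreeMonoid.lift_eval_of, Sum.elim_inl, Sum.elim_inr, h]
    rw [add_right_comm, add_comm (i x), add_right_comm]
  · simp only [FreeMonoid.lift_eval_of, Sum.elim_inr, FreeMonoid.length_mul, hW, hP]
    have := hi v
    linarith

theorem Len_xabyEquation (hab : a ≠ b) (hxy : x ≠ y) (hV : ∀ v : V, v = x ∨ v = y) :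
    (xabyEquation a b x y).Len = {n : V → ℕ | 1 < Nat.gcd (n x + 2) (n y + 2)} :=
  Set.ext fun _ => ⟨one_lt_gcd_of_mem_Len hab, mem_Len_of_one_lt_gcd hxy hV⟩

end LengthAbstraction

theorem Nat.one_lt_gcd_two_add_two_iff (m : ℕ) : 1 < Nat.gcd 2 (m + 2) ↔ m ≡ 0 [MOD 2] := by
  rw [Nat.gcd_add_self_right, Nat.modEq_zero_iff_dvd]
  constructor
  · intro h
    have h2 : Nat.gcd 2 m ≤ 2 := Nat.gcd_le_left _ (by norm_num)
    have : Nat.gcd 2 m = 2 := by omega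
    exact this ▸ Nat.gcd_dvd_right 2 m
  · intro h
    rw [Nat.gcd_eq_left h]
    norm_num

theorem Nat.one_lt_gcd_add_two_iff (m n : ℕ) : 1 < Nat.gcd (m + 2) (n + 2) ↔
    m = n ∨ (m = 0 ∧ n ≡ 0 [MOD 2]) ∨ (n = 0 ∧ m ≡ 0 [MOD 2]) ∨
      (0 < m ∧ 0 < n ∧ 1 < Nat.gcd (m + 2) (n + 2)) := by
  have key : m = n → 1 < Nat.gcd (m + 2) (n + 2) := by
    rintro rfl
    simp
  rcases m.eq_zero_or_pos with rfl | hm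
  · have := Nat.one_lt_gcd_two_add_two_iff n
    rw [zero_add] at key ⊢
    have h0 : n = 0 ∧ 0 ≡ 0 [MOD 2] → 1 < Nat.gcd 2 (n + 2) := fun h => key h.1.symm
    tauto
  · rcases n.eq_zero_or_pos with rfl | hn
    · have := Nat.one_lt_gcd_two_add_two_iff m
      rw [Nat.gcd_comm] at this
      simp only [zero_add] at key ⊢
      have : m ≠ 0 := hm.ne'
      tauto
    · have h1 : m ≠ 0 := hm.ne'
      have h2 : n ≠ 0 := hn.ne'
      simp only [h1, h2, hm, hn, false_and, true_and, false_or]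
      tauto

section Presburger

open FirstOrder Language

theorem Int.isSemilinearSet_Ici (c : ℤ) : IsSemilinearSet (Set.Ici c) := by
  refine IsLinearSet.isSemilinearSet ⟨c, {1}, Set.finite_singleton _, ?_⟩
  ext z
  simp only [Set.mem_Ici, Set.mem_vadd_set, SetLike.mem_coe, AddSubmonoid.mem_closure_singleton,
    vadd_eq_add]
  constructor
  · intro h
    exact ⟨z - c, ⟨(z - c).toNat, by simp; omega⟩, by ring⟩
  · rintro ⟨_, ⟨k, rfl⟩, rfl⟩
    simp

namespace IntPresburger

variable {α : Type*}

/-- Terms of integer Presburger arithmetic are affine functions. -/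
theorem exists_term_realize_eq (t : intPresburger.Term α) :
    ∃ (k : ℤ) (f : (α → ℤ) →+ ℤ), ∀ v : α → ℤ, t.realize v = k + f v := by
  induction t with
  | var i => exact ⟨0, Pi.evalAddMonoidHom _ i, by simp⟩
  | func g ts ih =>
    choose k f ih using ih
    cases g with
    | zero => exact ⟨0, 0, fun v => rfl⟩
    | one => exact ⟨1, 0, fun v => rfl⟩
    | neg =>
      refine ⟨-k 0, -f 0, fun v => ?_⟩
      change -(ts 0).realize v = _
      rw [ih, AddMonoidHom.neg_apply, neg_add]
    | add =>
      refine ⟨k 0 + k 1, f 0 + f 1, fun v => ?_⟩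
      change (ts 0).realize v + (ts 1).realize v = _
      rw [ih, ih, AddMonoidHom.add_apply]
      ring

variable [Finite α]

/-- Atoms are preimages of points or rays under affine maps; a universal quantifier is the
complement of a projection of a complement. -/
theorem isSemilinearSet_boundedFormula_realize {n} (φ : intPresburger.BoundedFormula α n) :
    IsSemilinearSet {v : α ⊕ Fin n → ℤ | φ.Realize (v ∘ Sum.inl) (v ∘ Sum.inr)} := by
  induction φ with simp only [BoundedFormula.Realize]
  | equal t₁ t₂ =>
    obtain ⟨k₁, f₁, h₁⟩ := exists_term_realize_eq t₁
    obtain ⟨k₂, f₂, h₂⟩ := exists_term_realize_eq t₂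
    simp only [Sum.elim_comp_inl_inr, h₁, h₂]
    exact isSemilinearSet_setOfPred_eq k₁ k₂ f₁ f₂
  | rel r ts =>
    cases r
    obtain ⟨k₁, f₁, h₁⟩ := exists_term_realize_eq (ts 0)
    obtain ⟨k₂, f₂, h₂⟩ := exists_term_realize_eq (ts 1)
    convert! (Int.isSemilinearSet_Ici (k₁ - k₂)).preimage (f₂ - f₁) using 1
    ext v
    simp only [Sum.elim_comp_inl_inr, Set.mem_ofPred_eq, Set.mem_preimage, Set.mem_Ici,
      AddMonoidHom.sub_apply]
    change (ts 0).realize v ≤ (ts 1).realize v ↔ _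
    rw [h₁, h₂]
    constructor <;> intro h <;> linarith
  | falsum => exact .empty
  | imp _ _ ih₁ ih₂ =>
    convert! (ih₂.compl.inter ih₁).compl using 1
    simp [Set.ofPred_inter_eq_sep, imp_iff_not_or, Set.compl_ofPred]
  | @all n φ ih =>
    let e := (Equiv.sumAssoc α (Fin n) (Fin 1)).trans (Equiv.sumCongr (.refl α) finSumFinEquiv)
    rw [← isSemilinearSet_image_iff (LinearEquiv.funCongrLeft ℤ ℤ e)] at ih
    convert! ih.compl.proj.compl using 1
    simp_rw [Set.compl_ofPred, not_exists, Fin.forall_fin_succ_pi, Fin.forall_fin_zero_pi,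
      Set.mem_compl_iff, Set.mem_image, not_not, ← LinearEquiv.eq_symm_apply,
      LinearEquiv.funCongrLeft_symm, exists_eq_right, Set.mem_ofPred,
      LinearEquiv.funCongrLeft_apply, LinearMap.funLeft, LinearMap.coe_mk, AddHom.coe_mk]
    congr! 4
    ext i
    cases i using Fin.lastCases <;> simp [e]

theorem isSemilinearSet_formula_realize (φ : intPresburger.Formula α) :
    IsSemilinearSet {v : α → ℤ | φ.Realize v} := by
  let e := Equiv.sumEmpty α (Fin 0)
  convert! (isSemilinearSet_boundedFormula_realize φ).image (LinearMap.funLeft ℤ ℤ e.symm)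
  ext x
  simp only [Set.mem_ofPred_eq, Set.mem_image]
  rw [(e.arrowCongr (.refl ℤ)).exists_congr_left]
  simp [Formula.Realize, Unique.eq_default, Function.comp_def, LinearMap.funLeft, e]

end IntPresburger

theorem PresburgerDefinable.isSemilinearSet {V : Type*} [Finite V] {S : Set (V → ℕ)}
    (h : PresburgerDefinable S) : IsSemilinearSet S := by
  obtain ⟨φ, hφ⟩ := h
  convert! (IntPresburger.isSemilinearSet_formula_realize φ).preimage
    ((Nat.castAddMonoidHom ℤ).compLeft V) using 1
  ext n
  exact hφ n

end Presburger

theorem Nat.not_isSemilinearSet_prime_add_two : ¬ IsSemilinearSet {m : ℕ | (m + 2).Prime} := by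
  rw [Nat.isSemilinearSet_iff_ultimately_periodic]
  rintro ⟨k, p, hp, h⟩
  -- Starting past the threshold, the period `p` carries primality along `q + j * p`; at `j = q`
  -- this is `q * (1 + p)`.
  obtain ⟨q, hq, hqp⟩ := Nat.exists_infinite_primes (k + 2)
  have hall : ∀ j, (q + j * p).Prime := by
    intro j
    induction j with
    | zero => simpa using hqp
    | succ j ih =>
      have := (h (q + j * p - 2) (by omega)).1
      simp only [Set.mem_ofPred_eq] at this
      rw [show q + j * p - 2 + 2 = q + j * p by omega,
        show q + j * p - 2 + p + 2 = q + (j + 1) * p by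
          rw [add_mul]; omega] at this
      exact this ih
  have := hall q
  rw [← mul_one_add] at this
  exact Nat.not_prime_mul hqp.one_lt.ne' (by omega) this

theorem Nat.prime_add_two_iff_forall_lt (m : ℕ) :
    (m + 2).Prime ↔ ∀ n < m, ¬ 1 < Nat.gcd (n + 2) (m + 2) := by
  constructor
  · intro hp n hn h
    exact h.ne' (Nat.coprime_of_lt_prime (by omega) (by omega) hp).symm
  · intro h
    by_contra hp
    have h2 := (Nat.minFac_prime (n := m + 2) (by omega)).two_le
    have hlt := (Nat.not_prime_iff_minFac_lt (n := m + 2) (by omega)).1 hp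
    -- For composite `m + 2`, the least prime factor is a smaller number sharing a factor with it.
    apply h ((m + 2).minFac - 2) (by omega)
    rw [Nat.sub_add_cancel h2, Nat.gcd_eq_left (Nat.minFac_dvd _)]
    exact h2

theorem not_isSemilinearSet_one_lt_gcd {V : Type*} [Finite V] {x y : V} (hxy : x ≠ y) :
    ¬ IsSemilinearSet {n : V → ℕ | 1 < Nat.gcd (n x + 2) (n y + 2)} := by
  classical
  intro hS
  have hlt : IsSemilinearSet {n : V → ℕ | n x < n y} := by
    convert! (Int.isSemilinearSet_Ici 1).preimage
      ((Nat.castAddMonoidHom ℤ).comp (Pi.evalAddMonoidHom (fun _ : V => ℕ) y) -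
        (Nat.castAddMonoidHom ℤ).comp (Pi.evalAddMonoidHom (fun _ : V => ℕ) x)) using 1
    ext n
    simp
    omega
  apply Nat.not_isSemilinearSet_prime_add_two
  convert! ((hS.inter hlt).image (Pi.evalAddMonoidHom (fun _ : V => ℕ) y)).compl using 1
  ext m
  simp only [Set.mem_ofPred_eq, Nat.prime_add_two_iff_forall_lt, Set.mem_compl_iff, Set.mem_image,
    Set.mem_inter_iff, Pi.evalAddMonoidHom_apply, not_exists, not_and]
  constructor
  · rintro h n ⟨h1, h2⟩ rfl
    exact h _ h2 h1
  · intro h n hn h1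
    -- A preimage of `m` under the projection: `n` at `x`, `m` elsewhere.
    refine h (Function.update (fun _ => m) x n) ⟨?_, ?_⟩ ?_ <;>
      simp [Function.update_of_ne hxy.symm, hn, h1]

theorem not_presburgerDefinable_Len_xabyEquation {A V : Type*} [Finite V] {a b : A} {x y : V}
    (hab : a ≠ b) (hxy : x ≠ y) (hV : ∀ v : V, v = x ∨ v = y) :
    ¬ PresburgerDefinable (xabyEquation a b x y).Len := by
  rw [Len_xabyEquation hab hxy hV]
  exact fun h => not_isSemilinearSet_one_lt_gcd hxy h.isSemilinearSet

theorem mainTheorem1 :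
    (∀ {A V : Type*} [Finite A] [Finite V] (a b : A) (x y : V),
      a ≠ b → x ≠ y → (∀ v : V, v = x ∨ v = y) →
        (xabyEquation a b x y).IsQuadratic ∧
        (xabyEquation a b x y).Len =
          {n : V → ℕ | n x = n y ∨
            (n x = 0 ∧ n y ≡ 0 [MOD 2]) ∨ (n y = 0 ∧ n x ≡ 0 [MOD 2]) ∨
            (0 < n x ∧ 0 < n y ∧ 1 < Nat.gcd (n x + 2) (n y + 2))} ∧
        ¬ PresburgerDefinable (xabyEquation a b x y).Len) ∧
    (∃ (A V : Type) (_ : Finite A) (_ : Finite V) (E : WordEquation A V),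
      E.IsQuadratic ∧ ¬ PresburgerDefinable E.Len) := by
  refine ⟨fun a b x y hab hxy hV => ⟨xabyEquation_isQuadratic hxy, ?_,
    not_presburgerDefinable_Len_xabyEquation hab hxy hV⟩,
    Bool, Bool, inferInstance, inferInstance, xabyEquation false true false true,
    xabyEquation_isQuadratic (by simp),
    not_presburgerDefinable_Len_xabyEquation (by simp) (by simp) (by simp)⟩
  rw [Len_xabyEquation hab hxy hV]
  ext n
  exact Nat.one_lt_gcd_add_two_iff (n x) (n y)
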